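/- Let $[0,1]$ be the standard MV-algebra, with $\neg a=1-a$, $a\oplus b=\min(1,a+b)$, $a\odot b=\max(0,a+b-1)$. Let $\mathcal I([0,1])$ be the set of intervals $[a,b]=\{\xi\in[0,1]\mid a\le\xi\le b\}$, $0\le a\le b\le 1$, equipped with the constants $0=[0,0]$, $1=[1,1]$, $\mathrm i=[0,1]$, the pointwise operations $$\neg x=\{\neg\alpha\mid\alpha\in x\},\quad x\oplus y=\{\alpha\oplus\beta\mid\alpha\in x,\ \beta\in y\},\quad x\odot y=\{\alpha\odot\beta\mid\alpha\in x,\ \beta\in y\},$$ and the operations $\Delta[a,b]=[a,a]$, $\nabla[a,b]=[b,b]$. Let $\mathsf{FORM}(X_1,\dots,X_n)$ be the absolutely free algebra of terms in the variables $X_1,\dots,X_n$ over the signature $(0,1,\mathrm i,\neg,\Delta,\nabla,\oplus,\odot)$. A valuation is a homomorphism $\eta\colon\mathsf{FORM}(X_1,\dots,X_n)\to\mathcal I([0,1])$. A formula $\sigma$ is a tautology if $\eta(\sigma)=1$ for every valuation $\eta$. We write $\theta_1,\dots,\theta_m\vdash_{\rm IMV}\psi$ if every valuation $\eta$ with $\eta(\theta_1)=\dots=\eta(\theta_m)=1$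 also satisfies $\eta(\psi)=1$. Let $u\to v$ abbreviate $\neg u\oplus v$; Modus Ponens is the rule that infers $v$ from $u$ and $u\to v$. **Theorem.** Let $\theta_1,\dots,\theta_m,\psi\in\mathsf{FORM}(X_1,\dots,X_n)$ and let $A=\Delta\theta_1\odot\dots\odot\Delta\theta_m$ (which for $m=0$ is the constant $1$). The following conditions are equivalent: (i) $\theta_1,\dots,\theta_m\vdash_{\rm IMV}\psi$. (ii) For some integer $k>0$ the formula $\underbrace{\neg A\oplus\dots\oplus\neg A}_{k\text{ times}}\oplus\Delta\psi$ is a tautology. (iii) For some integer $k>0$ the formula $(\underbrace{A\odot\dots\odot A}_{k\text{ times}})\to\Delta\psi$ is a tautology. (iv) $\Delta\psi$ is obtainable via Modus Ponens from $A$ and the tautologies. (Iterated $\odot$ and $\oplus$ are bracketed to the left.) -/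

import Mathlib

namespace IMV

/-! ### The standard MV-algebra on the real unit interval -/

/-- Lukasiewicz negation `1 - a`. -/
def luNeg (a : unitInterval) : unitInterval := unitInterval.symm a

/-- Truncated sum `min 1 (a + b)`. -/
def luOplus (a b : unitInterval) : unitInterval :=
  ⟨min 1 ((a : ℝ) + b), le_min zero_le_one (add_nonneg a.2.1 b.2.1), min_le_left _ _⟩

/-- Lukasiewicz conjunction `max 0 (a + b - 1)`. -/
def luOdot (a b : unitInterval) : unitInterval :=
  ⟨max 0 ((a : ℝ) + b - 1), le_max_left _ _,
    max_le zero_le_one (by linarith [a.2.2, b.2.2])⟩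

theorem luOplus_mono {a b c d : unitInterval} (h₁ : a ≤ b) (h₂ : c ≤ d) :
    luOplus a c ≤ luOplus b d := by
  have h₁' : (a : ℝ) ≤ b := h₁
  have h₂' : (c : ℝ) ≤ d := h₂
  exact Subtype.coe_le_coe.mp (min_le_min le_rfl (add_le_add h₁' h₂'))

theorem luOdot_mono {a b c d : unitInterval} (h₁ : a ≤ b) (h₂ : c ≤ d) :
    luOdot a c ≤ luOdot b d := by
  have h₁' : (a : ℝ) ≤ b := h₁
  have h₂' : (c : ℝ) ≤ d := h₂
  exact Subtype.coe_le_coe.mp (max_le_max le_rfl (by linarith))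

/-! ### The algebra of intervals of the unit interval

An interval `[α, β]` with `α ≤ β` is given by its two end points; the operations are the pointwise
(Minkowski) ones, as the lemmas `coe_neg`, `coe_oplus`, `coe_odot`, … below confirm. -/

/-- The set `I([0,1])` of nonempty closed intervals `[α, β] = {ξ | α ≤ ξ ≤ β}` of `[0,1]`. -/
abbrev I01 : Type := NonemptyInterval unitInterval

namespace I01

/-- The degenerate interval `[0,0]`. -/
def zero : I01 := ⟨(0, 0), le_rfl⟩

/-- The degenerate interval `[1,1]`. -/
def one : I01 := ⟨(1, 1), le_rfl⟩

/-- The constant `[0,1]`. -/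
def iota : I01 := ⟨(0, 1), unitInterval.le_one'⟩

/-- Pointwise negation: `¬[a,b] = [¬b,¬a]`. -/
def neg (x : I01) : I01 :=
  ⟨(luNeg x.snd, luNeg x.fst), unitInterval.symm_le_symm.mpr x.fst_le_snd⟩

/-- Lower collapse: `Δ[a,b] = [a,a]`. -/
def delta (x : I01) : I01 := ⟨(x.fst, x.fst), le_rfl⟩

/-- Upper collapse: `∇[a,b] = [b,b]`. -/
def nabla (x : I01) : I01 := ⟨(x.snd, x.snd), le_rfl⟩

/-- Truncated Minkowski sum: `[a,b] ⊕ [c,d] = [a ⊕ c, b ⊕ d]`. -/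
def oplus (x y : I01) : I01 :=
  ⟨(luOplus x.fst y.fst, luOplus x.snd y.snd), luOplus_mono x.fst_le_snd y.fst_le_snd⟩

/-- Pointwise Lukasiewicz conjunction: `[a,b] ⊙ [c,d] = [a ⊙ c, b ⊙ d]`. -/
def odot (x y : I01) : I01 :=
  ⟨(luOdot x.fst y.fst, luOdot x.snd y.snd), luOdot_mono x.fst_le_snd y.fst_le_snd⟩

theorem coe_zero : (zero : Set unitInterval) = {0} := by
  simp [zero, NonemptyInterval.coe_def]

theorem coe_one : (one : Set unitInterval) = {1} := by
  simp [one, NonemptyInterval.coe_def]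

theorem coe_iota : (iota : Set unitInterval) = Set.univ := by
  exact Set.eq_univ_of_forall fun _ => ⟨unitInterval.nonneg', unitInterval.le_one'⟩

theorem coe_delta (x : I01) :
    IsLeast (x : Set unitInterval) x.fst ∧ (delta x : Set unitInterval) = {x.fst} :=
  ⟨⟨⟨le_rfl, x.fst_le_snd⟩, fun _ h => h.1⟩, by simp [delta, NonemptyInterval.coe_def]⟩

theorem coe_nabla (x : I01) :
    IsGreatest (x : Set unitInterval) x.snd ∧ (nabla x : Set unitInterval) = {x.snd} :=
  ⟨⟨⟨x.fst_le_snd, le_rfl⟩, fun _ h => h.2⟩, by simp [nabla, NonemptyInterval.coe_def]⟩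

theorem coe_neg (x : I01) : (neg x : Set unitInterval) = luNeg '' (x : Set unitInterval) := by
  ext c
  constructor
  · rintro ⟨h₁, h₂⟩
    exact ⟨luNeg c, ⟨unitInterval.le_symm_comm.mp h₂, unitInterval.symm_le_comm.mp h₁⟩,
      unitInterval.symm_symm c⟩
  · rintro ⟨a, ⟨h₁, h₂⟩, rfl⟩
    exact ⟨unitInterval.symm_le_symm.mpr h₂, unitInterval.symm_le_symm.mpr h₁⟩

/-- A real number between `a + b` and `a' + b'` splits as a sum of points of the two intervals. -/
theorem exists_add_eq {a a' b b' : unitInterval} {c : ℝ} (ha : a ≤ a') (hb : b ≤ b')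
    (h₁ : (a : ℝ) + b ≤ c) (h₂ : c ≤ (a' : ℝ) + b') :
    ∃ μ ∈ Set.Icc a a', ∃ ν ∈ Set.Icc b b', (μ : ℝ) + ν = c := by
  have ha' : (a : ℝ) ≤ a' := ha
  have hb' : (b : ℝ) ≤ b' := hb
  have a0 := a.2.1
  have a1 := a'.2.2
  have b0 := b.2.1
  have b1 := b'.2.2
  rcases le_total ((b' : ℝ)) (c - a) with h | h
  · refine ⟨⟨c - b', by linarith, by linarith⟩, ⟨?_, ?_⟩, b', ⟨hb, le_rfl⟩, by simp⟩
    · exact Subtype.coe_le_coe.mp (show (a : ℝ) ≤ c - b' by linarith)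
    · exact Subtype.coe_le_coe.mp (show c - b' ≤ (a' : ℝ) by linarith)
  · refine ⟨a, ⟨le_rfl, ha⟩, ⟨c - a, by linarith, by linarith⟩, ⟨?_, ?_⟩, by simp⟩
    · exact Subtype.coe_le_coe.mp (show (b : ℝ) ≤ c - a by linarith)
    · exact Subtype.coe_le_coe.mp (show c - a ≤ (b' : ℝ) by linarith)

theorem coe_oplus (x y : I01) :
    (oplus x y : Set unitInterval) = Set.image2 luOplus (x : Set unitInterval) y := by
  ext c
  constructor
  · rintro ⟨h₁, h₂⟩
    have h₁' : min 1 ((x.fst : ℝ) + y.fst) ≤ c := h₁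
    have h₂' : (c : ℝ) ≤ min 1 ((x.snd : ℝ) + y.snd) := h₂
    have hc : (c : ℝ) ≤ 1 := c.2.2
    rcases le_total 1 ((x.fst : ℝ) + y.fst) with h | h
    · refine ⟨x.fst, ⟨le_rfl, x.fst_le_snd⟩, y.fst, ⟨le_rfl, y.fst_le_snd⟩, Subtype.ext ?_⟩
      rw [min_eq_left h] at h₁'
      exact (min_eq_left h).trans (le_antisymm h₁' hc)
    · rw [min_eq_right h] at h₁'
      obtain ⟨μ, hμ, ν, hν, e⟩ := exists_add_eq x.fst_le_snd y.fst_le_snd h₁'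
        (h₂'.trans (min_le_right _ _))
      exact ⟨μ, hμ, ν, hν, Subtype.ext (by simp [luOplus, e, hc])⟩
  · rintro ⟨a, ⟨h₁, h₂⟩, b, ⟨h₃, h₄⟩, rfl⟩
    exact ⟨luOplus_mono h₁ h₃, luOplus_mono h₂ h₄⟩

theorem coe_odot (x y : I01) :
    (odot x y : Set unitInterval) = Set.image2 luOdot (x : Set unitInterval) y := by
  ext c
  constructor
  · rintro ⟨h₁, h₂⟩
    have h₁' : max 0 ((x.fst : ℝ) + y.fst - 1) ≤ c := h₁
    have h₂' : (c : ℝ) ≤ max 0 ((x.snd : ℝ) + y.snd - 1) := h₂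
    have hc : (0 : ℝ) ≤ c := c.2.1
    rcases le_total ((x.snd : ℝ) + y.snd - 1) 0 with h | h
    · refine ⟨x.snd, ⟨x.fst_le_snd, le_rfl⟩, y.snd, ⟨y.fst_le_snd, le_rfl⟩, Subtype.ext ?_⟩
      rw [max_eq_left h] at h₂'
      exact (max_eq_left h).trans (le_antisymm hc h₂')
    · rw [max_eq_right h] at h₂'
      have h₃ := (le_max_right _ _).trans h₁'
      obtain ⟨μ, hμ, ν, hν, e⟩ := exists_add_eq (c := (c : ℝ) + 1) x.fst_le_snd y.fst_le_snd
        (by linarith) (by linarith)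
      exact ⟨μ, hμ, ν, hν, Subtype.ext (by simp [luOdot, e, hc])⟩
  · rintro ⟨a, ⟨h₁, h₂⟩, b, ⟨h₃, h₄⟩, rfl⟩
    exact ⟨luOdot_mono h₁ h₃, luOdot_mono h₂ h₄⟩

end I01

/-! ### Formulas, valuations, tautologies and consequence -/

/-- `FORM(X₁,…,Xₙ)`: the absolutely free algebra of IMV-terms in `n` variables. -/
inductive Form (n : ℕ) : Type
  | var (i : Fin n) : Form n
  | zero : Form n
  | one : Form n
  | iota : Form n
  | neg (u : Form n) : Form n
  | delta (u : Form n) : Form n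
  | nabla (u : Form n) : Form n
  | oplus (u v : Form n) : Form n
  | odot (u v : Form n) : Form n

namespace Form

variable {n : ℕ}

/-- The implication connective `u → v`, an abbreviation for `¬u ⊕ v`. -/
def imp (u v : Form n) : Form n := oplus (neg u) v

/-- `u₁ ⊙ u₂ ⊙ … ⊙ u_r`, bracketed to the left; the empty conjunction is the constant `1`. -/
def bigOdot : List (Form n) → Form n
  | [] => one
  | u :: l => l.foldl odot u

/-- `u₁ ⊕ u₂ ⊕ … ⊕ u_r`, bracketed to the left; the empty sum is the constant `0`. -/
def bigOplus : List (Form n) → Form n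
  | [] => zero
  | u :: l => l.foldl oplus u

end Form

/-- A valuation is a homomorphism of the algebra of IMV-terms into the algebra `I([0,1])`. -/
structure IsValuation {n : ℕ} (η : Form n → I01) : Prop where
  map_zero : η .zero = I01.zero
  map_one : η .one = I01.one
  map_iota : η .iota = I01.iota
  map_neg : ∀ u, η (.neg u) = I01.neg (η u)
  map_delta : ∀ u, η (.delta u) = I01.delta (η u)
  map_nabla : ∀ u, η (.nabla u) = I01.nabla (η u)
  map_oplus : ∀ u v, η (.oplus u v) = I01.oplus (η u) (η v)
  map_odot : ∀ u v, η (.odot u v) = I01.odot (η u) (η v)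

/-- A tautology is a formula `σ` such that the equation `σ = 1` holds in `I([0,1])`. -/
def IsTautology {n : ℕ} (σ : Form n) : Prop :=
  ∀ η : Form n → I01, IsValuation η → η σ = I01.one

/-- `θ₁,…,θₘ ⊢ ψ`: each valuation that gives every `θᵢ` the value `1` also gives `ψ` the
value `1`. -/
def IsConsequence {n m : ℕ} (θ : Fin m → Form n) (ψ : Form n) : Prop :=
  ∀ η : Form n → I01, IsValuation η → (∀ i, η (θ i) = I01.one) → η ψ = I01.one

/-- The formulas obtainable from the formula `α` and the tautologies by Modus Ponens: from `u` and
`u → v` infer `v`. -/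
inductive MPDerivable {n : ℕ} (α : Form n) : Form n → Prop
  | hyp : MPDerivable α α
  | taut {u : Form n} (h : IsTautology u) : MPDerivable α u
  | mp {u v : Form n} (hu : MPDerivable α u) (huv : MPDerivable α (Form.imp u v)) :
      MPDerivable α v

/-- The formula `Δθ₁ ⊙ … ⊙ Δθₘ`. -/
def deltaConj {n m : ℕ} (θ : Fin m → Form n) : Form n :=
  Form.bigOdot (List.ofFn fun i => Form.delta (θ i))

end IMV

/-! The substantial implication is (i) → (ii). An interval is `1` exactly when its lower end point
is 1, so a formula has a defect: 1 minus the lower end point of its value. The end points of a value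
are piecewise linear in the end points of the variables. Condition (i) says that the defect g of ψ
vanishes wherever the defect f of A does. On a cell where both are linear it suffices to compare
them at finitely many generators: at each, either f > 0 or g ≤ 0, so some k gives g ≤ k f there.
Finitely many cells then give one k for all valuations, which is the inequality asserted by the
tautology in (ii).

To avoid affine pieces and compactness, everything is homogenised: the unit 1 becomes the absolute
value of an extra coordinate, and cells become finitely generated cones (`fg_inf_halfspace`,
`IsPL.exists_le_mul`, `exists_one_sub_le_mul`).

The rest is algebra: (ii) ↔ (iii) is De Morgan, (iii) → (iv) is currying, and (iv) → (i) is
soundness of Modus Ponens. -/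

namespace IMV

/-! ### Piecewise linear functions on finite-dimensional real vector spaces -/

section PiecewiseLinear

variable {V : Type*} [AddCommGroup V] [Module ℝ V]

/-- The intersection of a finitely generated cone with a closed half-space is finitely generated. -/
theorem fg_inf_halfspace {C : PointedCone ℝ V} (hC : C.FG) (l : V →ₗ[ℝ] ℝ) :
    ∃ D : PointedCone ℝ V, D.FG ∧ ∀ x, x ∈ D ↔ x ∈ C ∧ 0 ≤ l x := by
  obtain ⟨s, hs, rfl⟩ := Submodule.fg_def.1 hC
  set P : Set V := {x ∈ s | 0 ≤ l x} with hP
  set N : Set V := {x ∈ s | l x < 0} with hN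
  -- Fourier–Motzkin elimination: each pair of generators on opposite sides is combined into a
  -- vector on the hyperplane `l = 0`.
  set Z : Set V := Set.image2 (fun p q => l p • q + (-l q) • p) P N with hZ
  have hPs : P ⊆ s := Set.sep_subset _ _
  have hNs : N ⊆ s := Set.sep_subset _ _
  refine ⟨PointedCone.hull ℝ (P ∪ Z), Submodule.fg_span
    ((hs.subset hPs).union (.image2 _ (hs.subset hPs) (hs.subset hNs))), fun x => ⟨fun hx => ?_, ?_⟩⟩
  · induction hx using Submodule.span_induction with
    | mem x hx =>
      rcases hx with hx | ⟨p, hp, q, hq, rfl⟩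
      · exact ⟨Submodule.subset_span (hPs hx), hx.2⟩
      · refine ⟨add_mem (PointedCone.smul_mem _ hp.2 (Submodule.subset_span (hNs hq)))
          (PointedCone.smul_mem _ (by linarith [hq.2]) (Submodule.subset_span (hPs hp))), ?_⟩
        simp [mul_comm]
    | zero => simp
    | add x y _ _ hx hy => exact ⟨add_mem hx.1 hy.1, by simpa using add_nonneg hx.2 hy.2⟩
    | smul c x _ hx =>
      refine ⟨Submodule.smul_mem _ _ hx.1, ?_⟩
      rw [show l (c • x) = (c : ℝ) * l x from map_smul l (c : ℝ) x]
      exact mul_nonneg c.2 hx.2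
  · rintro ⟨hx, hlx⟩
    have hPT : ∀ a ∈ PointedCone.hull ℝ P, a ∈ PointedCone.hull ℝ (P ∪ Z) :=
      fun a ha => Submodule.span_mono Set.subset_union_left ha
    have hl : ∀ a ∈ PointedCone.hull ℝ P, 0 ≤ l a := fun a ha => by
      induction ha using Submodule.span_induction with
      | mem x hx => exact hx.2
      | zero => simp
      | add x y _ _ hx hy => simpa using add_nonneg hx hy
      | smul c x _ hx =>
        rw [show l (c • x) = (c : ℝ) * l x from map_smul l (c : ℝ) x]
        exact mul_nonneg c.2 hx
    -- Strictness matters below: if `l a = 0`, then `0 ≤ l (a + b)` must force `b = 0`.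
    have hneg : ∀ b ∈ PointedCone.hull ℝ N, b = 0 ∨ l b < 0 := fun b hb => by
      induction hb using Submodule.span_induction with
      | mem x hx => exact .inr hx.2
      | zero => simp
      | add x y _ _ hx hy =>
        rcases hx with rfl | hx
        · simpa using hy
        · rcases hy with rfl | hy
          · simpa using Or.inr hx
          · exact .inr (by rw [map_add]; linarith)
      | smul c x _ hx =>
        rcases hx with rfl | hx
        · simp
        · rcases eq_or_lt_of_le c.2 with hc | hc
          · exact .inl (show (c : ℝ) • x = 0 by rw [← hc, zero_smul])
          · rw [show l (c • x) = (c : ℝ) * l x from map_smul l (c : ℝ) x]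
            exact .inr (mul_neg_of_pos_of_neg hc hx)
    have hgen : ∀ p ∈ P, ∀ b ∈ PointedCone.hull ℝ N,
        l p • b + (-l b) • p ∈ PointedCone.hull ℝ (P ∪ Z) := fun p hp b hb => by
      induction hb using Submodule.span_induction with
      | mem q hq => exact Submodule.subset_span (.inr ⟨p, hp, q, hq, rfl⟩)
      | zero => simp
      | add x y _ _ hx hy =>
        convert add_mem hx hy using 1
        rw [map_add]
        module
      | smul c x _ hx =>
        convert Submodule.smul_mem _ c hx using 1
        rw [show l (c • x) = (c : ℝ) * l x from map_smul l (c : ℝ) x]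
        change l p • (c : ℝ) • x + _ = (c : ℝ) • _
        module
    have hmix : ∀ a ∈ PointedCone.hull ℝ P, ∀ b ∈ PointedCone.hull ℝ N,
        l a • b + (-l b) • a ∈ PointedCone.hull ℝ (P ∪ Z) := fun a ha b hb => by
      induction ha using Submodule.span_induction with
      | mem p hp => exact hgen p hp b hb
      | zero => simp
      | add x y _ _ hx hy =>
        convert add_mem hx hy using 1
        rw [map_add]
        module
      | smul c x _ hx =>
        convert Submodule.smul_mem _ c hx using 1
        rw [show l (c • x) = (c : ℝ) * l x from map_smul l (c : ℝ) x]
        change _ + _ • (c : ℝ) • x = (c : ℝ) • _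
        module
    have hsplit : s = P ∪ N := by
      ext y
      have := le_or_gt 0 (l y)
      simp only [hP, hN, Set.mem_union, Set.mem_sep_iff]
      tauto
    rw [hsplit, Submodule.span_union] at hx
    obtain ⟨a, ha, b, hb, rfl⟩ := Submodule.mem_sup.1 hx
    rw [map_add] at hlx
    rcases eq_or_lt_of_le (hl a ha) with h0 | h0
    · rcases hneg b hb with rfl | h
      · simpa using hPT a ha
      · linarith
    · have hb0 : l b ≤ 0 := by
        rcases hneg b hb with rfl | h
        · simp
        · exact h.le
      -- a + b = (l a)⁻¹ (l a · b − l b · a) + (l a)⁻¹ (l a + l b) · a, with both summands in the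
      -- new cone.
      have h1 := PointedCone.smul_mem _ (inv_nonneg.2 h0.le) (hmix a ha b hb)
      have h2 := PointedCone.smul_mem _ (r := (l a)⁻¹ * (l a + l b))
        (mul_nonneg (inv_nonneg.2 h0.le) hlx) (hPT a ha)
      convert add_mem h1 h2 using 1
      match_scalars <;> field_simp
      ring

/-- A function is (homogeneously) piecewise linear if every finitely generated cone is covered by
finitely many finitely generated subcones on each of which the function is linear. -/
def IsPL (h : V → ℝ) : Prop :=
  ∀ C : PointedCone ℝ V, C.FG → ∃ F : Set (PointedCone ℝ V), F.Finite ∧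
    (∀ D ∈ F, D.FG ∧ D ≤ C ∧ ∃ l : V →ₗ[ℝ] ℝ, ∀ x ∈ D, h x = l x) ∧ ∀ x ∈ C, ∃ D ∈ F, x ∈ D

theorem IsPL.linear (l : V →ₗ[ℝ] ℝ) : IsPL (fun x => l x) := fun C hC =>
  ⟨{C}, Set.finite_singleton _, by
    rintro D rfl
    exact ⟨hC, le_rfl, l, fun _ _ => rfl⟩, fun x hx => ⟨C, rfl, hx⟩⟩

/-- Replacing each member of a finite cover by a finite cover of it gives a finite cover. -/
theorem exists_refinement {C : PointedCone ℝ V} {F : Set (PointedCone ℝ V)} (hF : F.Finite)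
    (hcov : ∀ x ∈ C, ∃ D ∈ F, x ∈ D) {p : PointedCone ℝ V → Prop}
    (h : ∀ D ∈ F, ∃ G : Set (PointedCone ℝ V), G.Finite ∧ (∀ E ∈ G, p E) ∧
      ∀ x ∈ D, ∃ E ∈ G, x ∈ E) :
    ∃ G : Set (PointedCone ℝ V), G.Finite ∧ (∀ E ∈ G, p E) ∧ ∀ x ∈ C, ∃ E ∈ G, x ∈ E := by
  choose! G hfin hp hG using h
  refine ⟨⋃ D ∈ F, G D, hF.biUnion hfin, fun E hE => ?_, fun x hx => ?_⟩
  · obtain ⟨D, hD, hE⟩ := Set.mem_iUnion₂.1 hE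
    exact hp D hD E hE
  · obtain ⟨D, hD, hxD⟩ := hcov x hx
    obtain ⟨E, hE, hxE⟩ := hG D hD x hxD
    exact ⟨E, Set.mem_iUnion₂.2 ⟨D, hD, hE⟩, hxE⟩

/-- Two piecewise linear functions are linear on the members of a common finite cover. -/
theorem IsPL.exists_common {f g : V → ℝ} (hf : IsPL f) (hg : IsPL g) {C : PointedCone ℝ V}
    (hC : C.FG) :
    ∃ F : Set (PointedCone ℝ V), F.Finite ∧
      (∀ D ∈ F, D.FG ∧ D ≤ C ∧ ∃ l m : V →ₗ[ℝ] ℝ, ∀ x ∈ D, f x = l x ∧ g x = m x) ∧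
      ∀ x ∈ C, ∃ D ∈ F, x ∈ D := by
  obtain ⟨F, hF, hlin, hcov⟩ := hf C hC
  refine exists_refinement hF hcov fun D hD => ?_
  obtain ⟨hDfg, hDC, l, hl⟩ := hlin D hD
  obtain ⟨G, hG, hGlin, hGcov⟩ := hg D hDfg
  refine ⟨G, hG, fun E hE => ?_, hGcov⟩
  obtain ⟨hEfg, hED, m, hm⟩ := hGlin E hE
  exact ⟨hEfg, hED.trans hDC, l, m, fun x hx => ⟨hl x (hED hx), hm x hx⟩⟩

theorem IsPL.add {f g : V → ℝ} (hf : IsPL f) (hg : IsPL g) : IsPL (fun x => f x + g x) := by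
  intro C hC
  obtain ⟨F, hF, hlin, hcov⟩ := hf.exists_common hg hC
  refine ⟨F, hF, fun D hD => ?_, hcov⟩
  obtain ⟨hDfg, hDC, l, m, hlm⟩ := hlin D hD
  exact ⟨hDfg, hDC, l + m, fun x hx => by simp [hlm x hx]⟩

theorem IsPL.neg {f : V → ℝ} (hf : IsPL f) : IsPL (fun x => -f x) := by
  intro C hC
  obtain ⟨F, hF, hlin, hcov⟩ := hf C hC
  refine ⟨F, hF, fun D hD => ?_, hcov⟩
  obtain ⟨hDfg, hDC, l, hl⟩ := hlin D hD
  exact ⟨hDfg, hDC, -l, fun x hx => by simp [hl x hx]⟩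

theorem IsPL.sub {f g : V → ℝ} (hf : IsPL f) (hg : IsPL g) : IsPL (fun x => f x - g x) := by
  simpa only [sub_eq_add_neg] using hf.add hg.neg

/-- A cell on which the two functions are the linear forms `l` and `m` is cut by the hyperplane `l =
m`; on each half one form dominates, and both halves remain finitely generated. -/
theorem IsPL.max {f g : V → ℝ} (hf : IsPL f) (hg : IsPL g) : IsPL (fun x => max (f x) (g x)) := by
  intro C hC
  obtain ⟨F, hF, hlin, hcov⟩ := hf.exists_common hg hC
  refine exists_refinement hF hcov fun D hD => ?_
  obtain ⟨hDfg, hDC, l, m, hlm⟩ := hlin D hD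
  obtain ⟨D₁, hD₁, h₁⟩ := fg_inf_halfspace hDfg (l - m)
  obtain ⟨D₂, hD₂, h₂⟩ := fg_inf_halfspace hDfg (m - l)
  simp only [LinearMap.sub_apply, sub_nonneg] at h₁ h₂
  refine ⟨{D₁, D₂}, by simp, ?_, fun x hx => ?_⟩
  · rintro E (rfl | rfl)
    · refine ⟨hD₁, fun x hx => hDC ((h₁ x).1 hx).1, l, fun x hx => ?_⟩
      obtain ⟨hxD, h⟩ := (h₁ x).1 hx
      simp only [(hlm x hxD).1, (hlm x hxD).2, max_eq_left h]
    · refine ⟨hD₂, fun x hx => hDC ((h₂ x).1 hx).1, m, fun x hx => ?_⟩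
      obtain ⟨hxD, h⟩ := (h₂ x).1 hx
      simp only [(hlm x hxD).1, (hlm x hxD).2, max_eq_right h]
  · rcases le_total (m x) (l x) with h | h
    · exact ⟨D₁, .inl rfl, (h₁ x).2 ⟨hx, h⟩⟩
    · exact ⟨D₂, .inr rfl, (h₂ x).2 ⟨hx, h⟩⟩

theorem IsPL.min {f g : V → ℝ} (hf : IsPL f) (hg : IsPL g) : IsPL (fun x => min (f x) (g x)) := by
  have h := (hf.neg.max hg.neg).neg
  simpa only [max_neg_neg, neg_neg] using h

/-- On a finite-dimensional space, a piecewise linear function that is nonpositive on the zero set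
of a nonnegative piecewise linear function is bounded by a multiple of the latter. -/
theorem IsPL.exists_le_mul [Module.Finite ℝ V] {f g : V → ℝ} (hf : IsPL f) (hg : IsPL g)
    (hf0 : ∀ x, 0 ≤ f x) (h : ∀ x, f x = 0 → g x ≤ 0) :
    ∃ k : ℕ, 0 < k ∧ ∀ x, g x ≤ k * f x := by
  -- In finite dimension the whole space is itself a finitely generated cone, so finitely many cells
  -- cover it.
  obtain ⟨F, hF, hlin, hcov⟩ := hf.exists_common hg
    (C := ⊤) (Module.Finite.fg_top (R := {c : ℝ // 0 ≤ c}) (M := V))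
  have hcone : ∀ D ∈ F, ∃ k : ℕ, ∀ x ∈ D, g x ≤ k * f x := by
    intro D hD
    obtain ⟨hDfg, -, l, m, hlm⟩ := hlin D hD
    obtain ⟨s, hs, rfl⟩ := Submodule.fg_def.1 hDfg
    -- At a generator with f = 0 the hypothesis gives g ≤ 0 and any multiple works; elsewhere any
    -- integer above g / f does.
    have hpt : ∀ x ∈ s, ∃ k : ℕ, g x ≤ k * f x := fun x _ => by
      rcases eq_or_lt_of_le (hf0 x) with h0 | h0
      · exact ⟨0, by simpa using h x h0.symm⟩
      · obtain ⟨k, hk⟩ := exists_nat_ge (g x / f x)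
        exact ⟨k, (div_le_iff₀ h0).1 hk⟩
    choose! k hk using hpt
    obtain ⟨K, hK⟩ := (hs.image k).bddAbove
    refine ⟨K, fun x hx => ?_⟩
    rw [(hlm x hx).1, (hlm x hx).2]
    clear hcov hlin
    induction hx using Submodule.span_induction with
    | mem x hx =>
      rw [← (hlm x (Submodule.subset_span hx)).1, ← (hlm x (Submodule.subset_span hx)).2]
      exact (hk x hx).trans (mul_le_mul_of_nonneg_right
        (by exact_mod_cast hK ⟨x, hx, rfl⟩) (hf0 x))
    | zero => simp
    | add x y _ _ hx hy =>
      rw [map_add, map_add]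
      linarith
    | smul c x _ hx =>
      rw [show l (c • x) = (c : ℝ) * l x from map_smul l (c : ℝ) x,
        show m (c • x) = (c : ℝ) * m x from map_smul m (c : ℝ) x]
      have := mul_le_mul_of_nonneg_left hx c.2
      linarith
  choose! k hk using hcone
  obtain ⟨K, hK⟩ := (hF.image k).bddAbove
  refine ⟨K + 1, Nat.succ_pos K, fun x => ?_⟩
  obtain ⟨D, hD, hx⟩ := hcov x trivial
  refine (hk D hD x hx).trans (mul_le_mul_of_nonneg_right ?_ (hf0 x))
  exact_mod_cast (hK ⟨D, hD, rfl⟩).trans (Nat.le_succ K)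

/-- Piecewise linear functions are positively homogeneous. -/
theorem IsPL.map_smul {f : V → ℝ} (hf : IsPL f) {c : ℝ} (hc : 0 ≤ c) (x : V) :
    f (c • x) = c * f x := by
  -- A piece of the ray through `x` that contains `x` contains all its nonnegative multiples.
  obtain ⟨F, -, hlin, hcov⟩ := hf (PointedCone.hull ℝ {x}) (Submodule.fg_span (by simp))
  obtain ⟨D, hD, hx⟩ := hcov x (Submodule.subset_span rfl)
  obtain ⟨-, -, l, hl⟩ := hlin D hD
  rw [hl x hx, hl _ (PointedCone.smul_mem D hc hx), _root_.map_smul, smul_eq_mul]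

end PiecewiseLinear

/-! ### Evaluation of formulas -/

namespace I01

/-- A lower end point equal to 1 leaves no room above it. This reduces validity to lower end points.
-/
theorem eq_one_iff (y : I01) : y = one ↔ (y.fst : ℝ) = 1 := by
  refine ⟨fun h => by rw [h]; rfl, fun h => ?_⟩
  have h1 : y.fst = 1 := Subtype.ext h
  have h2 : y.snd = 1 := le_antisymm unitInterval.le_one' (h1 ▸ y.fst_le_snd)
  exact NonemptyInterval.ext (Prod.ext h1 h2)

theorem fst_neg (y : I01) : ((neg y).fst : ℝ) = 1 - y.snd := rfl

theorem fst_delta (y : I01) : (delta y).fst = y.fst := rfl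

theorem fst_oplus (y z : I01) : ((oplus y z).fst : ℝ) = min 1 ((y.fst : ℝ) + z.fst) := rfl

theorem fst_odot (y z : I01) : ((odot y z).fst : ℝ) = max 0 ((y.fst : ℝ) + z.fst - 1) := rfl

theorem neg_one_oplus (y : I01) : oplus (neg one) y = y := by
  refine NonemptyInterval.ext (Prod.ext (Subtype.ext ?_) (Subtype.ext ?_))
  · change min 1 (1 - (1 : ℝ) + y.fst) = y.fst
    rw [sub_self, zero_add, min_eq_right y.fst.2.2]
  · change min 1 (1 - (1 : ℝ) + y.snd) = y.snd
    rw [sub_self, zero_add, min_eq_right y.snd.2.2]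

theorem neg_odot (y z : I01) : neg (odot y z) = oplus (neg y) (neg z) := by
  have key (a b : ℝ) : 1 - max 0 (a + b - 1) = min 1 (1 - a + (1 - b)) := by
    rcases le_total (a + b - 1) 0 with h | h
    · rw [max_eq_left h, min_eq_left (by linarith), sub_zero]
    · rw [max_eq_right h, min_eq_right (by linarith)]
      ring
  exact NonemptyInterval.ext (Prod.ext (Subtype.ext (key _ _)) (Subtype.ext (key _ _)))

theorem oplus_assoc (x y z : I01) : oplus (oplus x y) z = oplus x (oplus y z) := by
  have key (a b c : unitInterval) :
      min (1 : ℝ) (min 1 ((a : ℝ) + b) + c) = min 1 (a + min 1 ((b : ℝ) + c)) := by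
    rcases min_cases (1 : ℝ) ((a : ℝ) + b) with h | h <;>
    rcases min_cases (1 : ℝ) ((b : ℝ) + c) with h' | h' <;>
    rw [h.1, h'.1] <;>
    first
      | rw [add_assoc]; done
      | rw [min_eq_left (by linarith [a.2.1, c.2.1]), min_eq_left (by linarith [a.2.1, c.2.1])]
  exact NonemptyInterval.ext (Prod.ext (Subtype.ext (key _ _ _)) (Subtype.ext (key _ _ _)))

theorem odot_eq_one_iff (y z : I01) : odot y z = one ↔ y = one ∧ z = one := by
  have h1 := y.fst.2.2
  have h2 := z.fst.2.2
  simp only [eq_one_iff, fst_odot]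
  constructor
  · intro h
    rcases max_cases (0 : ℝ) ((y.fst : ℝ) + z.fst - 1) with h' | h' <;>
      constructor <;> linarith [h'.1]
  · rintro ⟨h, h'⟩
    norm_num [h, h']

end I01

/-- The valuation with prescribed values on the variables. -/
def eval {n : ℕ} (x : Fin n → I01) : Form n → I01
  | .var i => x i
  | .zero => I01.zero
  | .one => I01.one
  | .iota => I01.iota
  | .neg u => I01.neg (eval x u)
  | .delta u => I01.delta (eval x u)
  | .nabla u => I01.nabla (eval x u)
  | .oplus u v => I01.oplus (eval x u) (eval x v)
  | .odot u v => I01.odot (eval x u) (eval x v)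

theorem isValuation_eval {n : ℕ} (x : Fin n → I01) : IsValuation (eval x) :=
  ⟨rfl, rfl, rfl, fun _ => rfl, fun _ => rfl, fun _ => rfl, fun _ _ => rfl, fun _ _ => rfl⟩

namespace IsValuation

variable {n : ℕ} {η : Form n → I01}

/-- Freeness of the term algebra: valuations are parametrised by the values of the variables, that
is, by finitely many real coordinates. -/
theorem eq_eval (hη : IsValuation η) (u : Form n) : η u = eval (fun i => η (.var i)) u := by
  induction u with
  | var i => rfl
  | zero => exact hη.map_zero
  | one => exact hη.map_one
  | iota => exact hη.map_iota
  | neg u ih => rw [hη.map_neg, ih, eval]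
  | delta u ih => rw [hη.map_delta, ih, eval]
  | nabla u ih => rw [hη.map_nabla, ih, eval]
  | oplus u v ihu ihv => rw [hη.map_oplus, ihu, ihv, eval]
  | odot u v ihu ihv => rw [hη.map_odot, ihu, ihv, eval]

theorem map_imp (hη : IsValuation η) (u v : Form n) :
    η (.imp u v) = I01.oplus (I01.neg (η u)) (η v) := by
  rw [Form.imp, hη.map_oplus, hη.map_neg]

theorem delta_eq_one_iff (hη : IsValuation η) (u : Form n) :
    η (.delta u) = I01.one ↔ η u = I01.one := by
  rw [hη.map_delta, I01.eq_one_iff, I01.eq_one_iff, I01.fst_delta]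

theorem foldl_odot_eq_one_iff (hη : IsValuation η) (l : List (Form n)) (u : Form n) :
    η (l.foldl .odot u) = I01.one ↔ η u = I01.one ∧ ∀ v ∈ l, η v = I01.one := by
  induction l generalizing u with
  | nil => simp
  | cons v l ih =>
    rw [List.foldl_cons, ih, hη.map_odot, I01.odot_eq_one_iff]
    simp [and_assoc]

theorem bigOdot_eq_one_iff (hη : IsValuation η) (l : List (Form n)) :
    η (.bigOdot l) = I01.one ↔ ∀ v ∈ l, η v = I01.one := by
  cases l with
  | nil => simp [Form.bigOdot, hη.map_one]
  | cons u l =>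
    rw [Form.bigOdot, hη.foldl_odot_eq_one_iff]
    simp

theorem deltaConj_eq_one_iff (hη : IsValuation η) {m : ℕ} (θ : Fin m → Form n) :
    η (deltaConj θ) = I01.one ↔ ∀ i, η (θ i) = I01.one := by
  rw [deltaConj, hη.bigOdot_eq_one_iff]
  simp [List.mem_ofFn, hη.delta_eq_one_iff]

theorem foldl_odot_fst_eq_snd (hη : IsValuation η) (l : List (Form n)) (u : Form n)
    (hu : (η u).fst = (η u).snd) (hl : ∀ v ∈ l, (η v).fst = (η v).snd) :
    (η (l.foldl .odot u)).fst = (η (l.foldl .odot u)).snd := by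
  induction l generalizing u with
  | nil => exact hu
  | cons v l ih =>
    refine ih _ ?_ fun w hw => hl w (List.mem_cons_of_mem _ hw)
    rw [hη.map_odot]
    change luOdot _ _ = luOdot _ _
    rw [hu, hl v List.mem_cons_self]

/-- Negation swaps end points, so the lower end point of ¬A involves the upper one of A, whereas
validity of A concerns the lower one. The Δ's in A make the two agree. -/
theorem deltaConj_fst_eq_snd (hη : IsValuation η) {m : ℕ} (θ : Fin m → Form n) :
    (η (deltaConj θ)).fst = (η (deltaConj θ)).snd := by
  have h : ∀ v ∈ List.ofFn fun i => Form.delta (θ i), (η v).fst = (η v).snd := by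
    intro v hv
    obtain ⟨i, rfl⟩ := List.mem_ofFn.1 hv
    rw [hη.map_delta]
    rfl
  rw [deltaConj]
  cases hl : List.ofFn fun i => Form.delta (θ i) with
  | nil => rw [Form.bigOdot, hη.map_one]; rfl
  | cons u l =>
    rw [hl] at h
    exact hη.foldl_odot_fst_eq_snd l u (h u List.mem_cons_self)
      fun v hv => h v (List.mem_cons_of_mem _ hv)

end IsValuation

theorem Form.bigOdot_replicate_succ {n : ℕ} (u : Form n) (k : ℕ) :
    bigOdot (List.replicate (k + 2) u) = odot (bigOdot (List.replicate (k + 1) u)) u := by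
  change List.foldl odot u (List.replicate (k + 1) u) =
    odot (List.foldl odot u (List.replicate k u)) u
  rw [List.replicate_succ', List.foldl_append]
  rfl

theorem Form.bigOplus_replicate_succ {n : ℕ} (u : Form n) (k : ℕ) :
    bigOplus (List.replicate (k + 2) u) = oplus (bigOplus (List.replicate (k + 1) u)) u := by
  change List.foldl oplus u (List.replicate (k + 1) u) =
    oplus (List.foldl oplus u (List.replicate k u)) u
  rw [List.replicate_succ', List.foldl_append]
  rfl

theorem IsValuation.bigOplus_replicate_neg {n : ℕ} {η : Form n → I01} (hη : IsValuation η)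
    (u : Form n) (k : ℕ) :
    η (.bigOplus (List.replicate (k + 1) (.neg u))) =
      I01.neg (η (.bigOdot (List.replicate (k + 1) u))) := by
  induction k with
  | zero => exact hη.map_neg u
  | succ k ih =>
    rw [Form.bigOplus_replicate_succ, Form.bigOdot_replicate_succ, hη.map_oplus, hη.map_odot, ih,
      hη.map_neg, I01.neg_odot]

theorem IsValuation.fst_bigOplus_replicate {n : ℕ} {η : Form n → I01} (hη : IsValuation η)
    (u : Form n) (k : ℕ) :
    ((η (.bigOplus (List.replicate (k + 1) u))).fst : ℝ) = min 1 ((k + 1 : ℕ) * ((η u).fst : ℝ)) := by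
  induction k with
  | zero =>
    change ((η u).fst : ℝ) = _
    simp [(η u).fst.2.2]
  | succ k ih =>
    rw [Form.bigOplus_replicate_succ, hη.map_oplus, I01.fst_oplus, ih]
    have h := (η u).fst.2.1
    push_cast
    rcases min_cases (1 : ℝ) ((k + 1) * ((η u).fst : ℝ)) with h' | h'
    · rw [h'.1, min_eq_left (by linarith), min_eq_left (by linarith)]
    · rw [h'.1]
      ring_nf

/-! ### End points of the values of a formula as piecewise linear functions -/

/-- A point records candidate end points for the values of the variables and a scaling factor. -/
abbrev Point (n : ℕ) : Type := (Fin n → ℝ) × (Fin n → ℝ) × ℝ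

/-- The absolute value of the scaling factor, which plays the role of the unit of `[0,1]`. -/
def unit {n : ℕ} (v : Point n) : ℝ := max v.2.2 (-v.2.2)

/-- The end points of the value of a formula, homogenised by means of the scaling factor. -/
def bounds {n : ℕ} : Form n → Point n → ℝ × ℝ
  -- Clamping makes every vector, not only those coming from intervals, encode a legitimate interval
  -- inside [0, unit].
  | .var i, v => (max 0 (min (unit v) (v.1 i)),
      max (max 0 (min (unit v) (v.1 i))) (min (unit v) (v.2.1 i)))
  | .zero, _ => (0, 0)
  | .one, v => (unit v, unit v)
  | .iota, v => (0, unit v)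
  | .neg u, v => (unit v - (bounds u v).2, unit v - (bounds u v).1)
  | .delta u, v => ((bounds u v).1, (bounds u v).1)
  | .nabla u, v => ((bounds u v).2, (bounds u v).2)
  | .oplus u w, v => (min (unit v) ((bounds u v).1 + (bounds w v).1),
      min (unit v) ((bounds u v).2 + (bounds w v).2))
  | .odot u w, v => (max 0 ((bounds u v).1 + (bounds w v).1 - unit v),
      max 0 ((bounds u v).2 + (bounds w v).2 - unit v))

variable {n : ℕ}

theorem unit_nonneg (v : Point n) : 0 ≤ unit v := abs_nonneg v.2.2

theorem isPL_unit : IsPL (unit (n := n)) := by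
  have h : IsPL fun v : Point n => v.2.2 :=
    .linear (LinearMap.snd ℝ (Fin n → ℝ) ℝ ∘ₗ LinearMap.snd ℝ (Fin n → ℝ) _)
  exact h.max h.neg

theorem isPL_bounds (u : Form n) :
    IsPL (fun v => (bounds u v).1) ∧ IsPL (fun v => (bounds u v).2) := by
  have h0 : IsPL fun _ : Point n => (0 : ℝ) := .linear 0
  have h1 := isPL_unit (n := n)
  induction u with
  | var i =>
    have hp : IsPL fun v : Point n => v.1 i :=
      .linear (V := Point n)
        (LinearMap.proj (φ := fun _ : Fin n => ℝ) i ∘ₗ LinearMap.fst ℝ (Fin n → ℝ) _)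
    have hq : IsPL fun v : Point n => v.2.1 i :=
      .linear (V := Point n) (LinearMap.proj (φ := fun _ : Fin n => ℝ) i ∘ₗ
        LinearMap.fst ℝ (Fin n → ℝ) ℝ ∘ₗ LinearMap.snd ℝ (Fin n → ℝ) _)
    exact ⟨h0.max (h1.min hp), (h0.max (h1.min hp)).max (h1.min hq)⟩
  | zero => exact ⟨h0, h0⟩
  | one => exact ⟨h1, h1⟩
  | iota => exact ⟨h0, h1⟩
  | neg u ih => exact ⟨h1.sub ih.2, h1.sub ih.1⟩
  | delta u ih => exact ⟨ih.1, ih.1⟩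
  | nabla u ih => exact ⟨ih.2, ih.2⟩
  | oplus u w ihu ihw => exact ⟨h1.min (ihu.1.add ihw.1), h1.min (ihu.2.add ihw.2)⟩
  | odot u w ihu ihw =>
    exact ⟨h0.max ((ihu.1.add ihw.1).sub h1), h0.max ((ihu.2.add ihw.2).sub h1)⟩

/-- Makes the homogenised defects nonnegative on the whole space, and leaves no freedom when the
unit is 0. -/
theorem bounds_mem (u : Form n) (v : Point n) :
    (bounds u v).1 ∈ Set.Icc 0 (unit v) ∧ (bounds u v).2 ∈ Set.Icc 0 (unit v) := by
  have h1 := unit_nonneg v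
  simp only [Set.mem_Icc]
  induction u with
  | var i => simp [bounds, h1]
  | zero => simp [bounds, h1]
  | one => simp [bounds, h1]
  | iota => simp [bounds, h1]
  | neg u ih =>
    simp only [bounds]
    refine ⟨⟨?_, ?_⟩, ?_, ?_⟩ <;> linarith [ih.1.1, ih.1.2, ih.2.1, ih.2.2]
  | delta u ih => exact ⟨ih.1, ih.1⟩
  | nabla u ih => exact ⟨ih.2, ih.2⟩
  | oplus u w ihu ihw =>
    exact ⟨⟨le_min h1 (add_nonneg ihu.1.1 ihw.1.1), min_le_left _ _⟩,
      le_min h1 (add_nonneg ihu.2.1 ihw.2.1), min_le_left _ _⟩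
  | odot u w ihu ihw =>
    exact ⟨⟨le_max_left _ _, max_le h1 (by linarith [ihu.1.2, ihw.1.2])⟩,
      le_max_left _ _, max_le h1 (by linarith [ihu.2.2, ihw.2.2])⟩

/-- At points with scaling factor `±1` the bounds are the end points of the values. -/
theorem bounds_eq_eval {v : Point n} (hv : unit v = 1) {x : Fin n → I01}
    (hx : ∀ i, bounds (.var i) v = (((x i).fst : ℝ), ((x i).snd : ℝ))) (u : Form n) :
    bounds u v = (((eval x u).fst : ℝ), ((eval x u).snd : ℝ)) := by
  induction u with
  | var i => exact hx i
  | zero => rfl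
  | one => rw [bounds, hv]; rfl
  | iota => rw [bounds, hv]; rfl
  | neg u ih => rw [bounds, hv, ih]; rfl
  | delta u ih => rw [bounds, ih]; rfl
  | nabla u ih => rw [bounds, ih]; rfl
  | oplus u w ihu ihw => rw [bounds, hv, ihu, ihw]; rfl
  | odot u w ihu ihw => rw [bounds, hv, ihu, ihw]; rfl

theorem exists_eval_eq_bounds {v : Point n} (hv : unit v = 1) :
    ∃ x : Fin n → I01, ∀ u, bounds u v = (((eval x u).fst : ℝ), ((eval x u).snd : ℝ)) := by
  have hmem (i : Fin n) := bounds_mem (.var i) v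
  rw [hv] at hmem
  refine ⟨fun i => ⟨(⟨(bounds (.var i) v).1, (hmem i).1⟩, ⟨(bounds (.var i) v).2, (hmem i).2⟩), ?_⟩,
    bounds_eq_eval hv fun i => rfl⟩
  exact Subtype.coe_le_coe.1 (le_max_left _ _)

theorem exists_bounds_eq_eval (x : Fin n → I01) :
    ∃ v : Point n, unit v = 1 ∧
      ∀ u, bounds u v = (((eval x u).fst : ℝ), ((eval x u).snd : ℝ)) := by
  have hv : unit ((fun i => ((x i).fst : ℝ), fun i => ((x i).snd : ℝ), 1) : Point n) = 1 := by
    norm_num [unit]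
  refine ⟨_, hv, bounds_eq_eval hv fun i => ?_⟩
  have h : ((x i).fst : ℝ) ≤ (x i).snd := (x i).fst_le_snd
  rw [bounds, hv]
  simp [min_eq_right (x i).fst.2.2, min_eq_right (x i).snd.2.2, max_eq_right (x i).fst.2.1, h]

/-- If `ψ` has value `1` whenever `α` has, then the defect of `ψ` is at most a fixed multiple of the
defect of `α`. -/
theorem exists_one_sub_le_mul {α ψ : Form n}
    (h : ∀ x, eval x α = I01.one → eval x ψ = I01.one) :
    ∃ k : ℕ, 0 < k ∧ ∀ x, 1 - ((eval x ψ).fst : ℝ) ≤ k * (1 - (eval x α).fst) := by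
  have hα := isPL_unit.sub (isPL_bounds α).1
  have hψ := isPL_unit.sub (isPL_bounds ψ).1
  have hzero (v : Point n) (hv : unit v - (bounds α v).1 = 0) : unit v - (bounds ψ v).1 ≤ 0 := by
    -- A point of unit 0 encodes no valuation, but its defects are trivially nonpositive; any other
    -- point is rescaled to unit 1, where the hypothesis on valuations applies.
    rcases eq_or_lt_of_le (unit_nonneg v) with h0 | h0
    · linarith [(bounds_mem ψ v).1.1]
    · have hc : 0 ≤ (unit v)⁻¹ := inv_nonneg.2 h0.le
      have h1 : unit ((unit v)⁻¹ • v) = 1 := by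
        rw [isPL_unit.map_smul hc, inv_mul_cancel₀ h0.ne']
      obtain ⟨x, hx⟩ := exists_eval_eq_bounds h1
      have hαv := hα.map_smul hc v
      have hψv := hψ.map_smul hc v
      simp only [h1, hx] at hαv hψv hv
      rw [hv, mul_zero] at hαv
      have h2 := (I01.eq_one_iff _).1 (h x ((I01.eq_one_iff _).2 (by linarith)))
      rw [h2, sub_self, zero_eq_mul] at hψv
      exact (hψv.resolve_left (inv_ne_zero h0.ne')).le
  obtain ⟨k, hk, hle⟩ := hα.exists_le_mul hψ (fun v => sub_nonneg.2 (bounds_mem α v).1.2) hzero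
  refine ⟨k, hk, fun x => ?_⟩
  obtain ⟨v, hv, hb⟩ := exists_bounds_eq_eval x
  simpa [hv, hb] using hle v

/-! ### Modus Ponens -/

theorem MPDerivable.sound {α u : Form n} (h : MPDerivable α u) {η : Form n → I01}
    (hη : IsValuation η) (hα : η α = I01.one) : η u = I01.one := by
  induction h with
  | hyp => exact hα
  | taut h => exact h η hη
  | mp _ _ hu huv => rwa [hη.map_imp, hu, I01.neg_one_oplus] at huv

/-- Currying: α^(k+2) → β has the same value as α^(k+1) → (α → β), so each factor α is discharged by
one application of Modus Ponens. -/
theorem MPDerivable.of_bigOdot_imp {α β : Form n} (k : ℕ)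
    (h : IsTautology (.imp (.bigOdot (List.replicate (k + 1) α)) β)) : MPDerivable α β := by
  induction k generalizing β with
  | zero => exact .mp .hyp (.taut h)
  | succ k ih =>
    refine .mp .hyp (ih fun η hη => ?_)
    rw [← h η hη, Form.bigOdot_replicate_succ]
    simp only [hη.map_imp, hη.map_odot, I01.neg_odot, I01.oplus_assoc]

end IMV

/-! ### The equivalence of the four conditions -/

theorem theorem7p1 (n m : ℕ) (θ : Fin m → IMV.Form n) (ψ : IMV.Form n) :
    List.TFAE [
      IMV.IsConsequence θ ψ,
      ∃ k : ℕ, 0 < k ∧ IMV.IsTautology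
        (IMV.Form.oplus
          (IMV.Form.bigOplus (List.replicate k (IMV.Form.neg (IMV.deltaConj θ))))
          (IMV.Form.delta ψ)),
      ∃ k : ℕ, 0 < k ∧ IMV.IsTautology
        (IMV.Form.imp
          (IMV.Form.bigOdot (List.replicate k (IMV.deltaConj θ)))
          (IMV.Form.delta ψ)),
      IMV.MPDerivable (IMV.deltaConj θ) (IMV.Form.delta ψ)] := by
  have h23 (k : ℕ) : IMV.IsTautology
        (IMV.Form.oplus
          (IMV.Form.bigOplus (List.replicate (k + 1) (IMV.Form.neg (IMV.deltaConj θ))))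
          (IMV.Form.delta ψ)) ↔ IMV.IsTautology
        (IMV.Form.imp
          (IMV.Form.bigOdot (List.replicate (k + 1) (IMV.deltaConj θ)))
          (IMV.Form.delta ψ)) := by
    refine forall₂_congr fun η hη => ?_
    rw [hη.map_imp, hη.map_oplus, hη.bigOplus_replicate_neg]
  tfae_have 1 → 2 := fun h => by
    obtain ⟨k, hk, hle⟩ := IMV.exists_one_sub_le_mul (α := IMV.deltaConj θ) (ψ := ψ) fun x hx =>
      h _ (IMV.isValuation_eval x) (((IMV.isValuation_eval x).deltaConj_eq_one_iff θ).1 hx)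
    obtain ⟨k, rfl⟩ := Nat.exists_eq_succ_of_ne_zero hk.ne'
    refine ⟨k + 1, hk, fun η hη => ?_⟩
    have h1 := hle fun i => η (.var i)
    rw [← hη.eq_eval, ← hη.eq_eval] at h1
    rw [hη.map_oplus, IMV.I01.eq_one_iff, IMV.I01.fst_oplus, hη.fst_bigOplus_replicate, hη.map_neg,
      hη.map_delta, IMV.I01.fst_neg, IMV.I01.fst_delta, ← hη.deltaConj_fst_eq_snd]
    refine min_eq_left ?_
    -- The sum reaches 1 once the defect of ψ is at most min(1, (k+1) · defect of A): the bound by 1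
    -- is automatic, the other is the multiple found above.
    rw [← sub_le_iff_le_add]
    exact le_min (by linarith [(η ψ).fst.2.1]) h1
  tfae_have 2 → 3 := by
    rintro ⟨_ | k, hk, h⟩
    · exact absurd hk (lt_irrefl 0)
    exact ⟨k + 1, hk, (h23 k).1 h⟩
  tfae_have 3 → 2 := by
    rintro ⟨_ | k, hk, h⟩
    · exact absurd hk (lt_irrefl 0)
    exact ⟨k + 1, hk, (h23 k).2 h⟩
  tfae_have 3 → 4 := by
    rintro ⟨_ | k, hk, h⟩
    · exact absurd hk (lt_irrefl 0)
    exact IMV.MPDerivable.of_bigOdot_imp k h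
  tfae_have 4 → 1 := fun h η hη hθ =>
    (hη.delta_eq_one_iff ψ).1 (h.sound hη ((hη.deltaConj_eq_one_iff θ).2 hθ))
  tfae_finish
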